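/- Let $L$ be a lattice of full rank in a finite-dimensional real vector space $H$ of dimension $b_2\ge 3$, and let $q$ be a symmetric bilinear form on $H$, integer-valued on $L$ and of signature $(3,b_2-3)$. (For a simple hyperk\"ahler manifold $M$ take $H=H^2(M,\mathbb R)$, $L$ the image of $H^2(M,\mathbb Z)$ and $q$ the Bogomolov--Beauville--Fujiki form.) Put $H_{\mathbb Q}=\{v\in H: nv\in L \text{ for some integer } n\ne 0\}$. Let $\mathbb P\mathrm{er}\cong SO(b_2-3,3)/SO(2)\times SO(b_2-3,1)$ be the period space, i.e. the Grassmannian of oriented $2$-dimensional subspaces $V\subset H$ with $q|_V$ positive definite, with its usual topology. For a $3$-dimensional subspace $W\subset H$ with $q|_W$ positive definite, let $S_W\subset\mathbb P\mathrm{er}$ be the set of oriented planes contained in $W$. Call $S_W$ a generic hyperk\"ahler (GHK) line if the $q$-orthogonal complement $W^\perp$ satisfies $W^\perp\cap H_{\mathbb Q}=0$. Fix a Euclidean metric $g$ on $H$. It induces on each sphere $S_W$ the round (Fubini--Study) metric, normalised so that the distance $d_g(V,V')$ between two points of $S_W$ is the angle in $[0,\pi]$ between the oriented $g$-unit normals of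 $V$ and $V'$ in $W$ (for a fixed orientation of $W$). For $x,y\in\mathbb P\mathrm{er}$ define the subtwistor function $$d_{tw}(x,y)=\inf\ \sum_{i=1}^{n} d_g(s_{i-1},s_i)\in[0,\infty],$$ where the infimum is over all $n\ge1$, all sequences $S_1,\dots,S_n$ of GHK lines and all points $s_0=x,s_1,\dots,s_n=y$ of $\mathbb P\mathrm{er}$ with $s_{i-1},s_i\in S_i$ for $i=1,\dots,n$, and the distance $d_g(s_{i-1},s_i)$ is computed on $S_i$. Then any two points $x,y\in\mathbb P\mathrm{er}$ are joined by a sequence of $4$ sequentially intersecting GHK lines (i.e. such a sequence with $n=4$ exists; repetitions are allowed), and (i) $d_{tw}$ is a metric on $\mathbb P\mathrm{er}$; in particular it is finite; (ii) the metric $d_{tw}$ induces the usual topology on $\mathbb P\mathrm{er}$. -/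

import Mathlib

namespace Subtwistor

variable {H : Type*} [NormedAddCommGroup H] [InnerProductSpace ℝ H]

/-- A subspace on which the symmetric form `q` is positive definite. -/
def IsPositive (q : LinearMap.BilinForm ℝ H) (W : Submodule ℝ H) : Prop :=
  ∀ w ∈ W, w ≠ 0 → 0 < q w w

/-- `q` has signature `(3, dim H - 3)`: the space is the `q`-orthogonal direct sum of a
three-dimensional positive definite subspace and a negative definite subspace. -/
def HasSignatureThree (q : LinearMap.BilinForm ℝ H) : Prop :=
  ∃ P N : Submodule ℝ H, IsCompl P N ∧ Module.finrank ℝ P = 3 ∧ IsPositive q P ∧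
    (∀ v ∈ N, v ≠ 0 → q v v < 0) ∧ ∀ u ∈ P, ∀ v ∈ N, q u v = 0

/-- Bases `(a, b)` of positive two-dimensional subspaces, topologized as a subspace of `H × H`. -/
abbrev PosFrame (q : LinearMap.BilinForm ℝ H) : Type _ :=
  {p : H × H // LinearIndependent ℝ ![p.1, p.2] ∧ IsPositive q (Submodule.span ℝ {p.1, p.2})}

/-- Two bases span the same plane and define the same orientation of it: the change of basis
has positive determinant. -/
def SameOrientedPlane (p p' : H × H) : Prop :=
  ∃ α β γ δ : ℝ, 0 < α * δ - β * γ ∧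
    p'.1 = α • p.1 + β • p.2 ∧ p'.2 = γ • p.1 + δ • p.2

theorem SameOrientedPlane.refl (p : H × H) : SameOrientedPlane p p :=
  ⟨1, 0, 0, 1, by norm_num, by simp, by simp⟩

theorem SameOrientedPlane.symm {p p' : H × H} (h : SameOrientedPlane p p') :
    SameOrientedPlane p' p := by
  obtain ⟨α, β, γ, δ, hD, h1, h2⟩ := h
  set D := α * δ - β * γ with hDdef
  have hne : D ≠ 0 := hD.ne'
  refine ⟨δ / D, -β / D, -γ / D, α / D, ?_, ?_, ?_⟩
  · have : δ / D * (α / D) - -β / D * (-γ / D) = 1 / D := by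
      field_simp
      rw [hDdef]; ring
    rw [this]; positivity
  · rw [h1, h2]
    have e1 : δ / D * α + -β / D * γ = 1 := by
      field_simp
      rw [hDdef]; ring
    have e2 : δ / D * β + -β / D * δ = 0 := by ring
    calc p.1 = (δ / D * α + -β / D * γ) • p.1 + (δ / D * β + -β / D * δ) • p.2 := by
          rw [e1, e2]; simp
      _ = _ := by module
  · rw [h1, h2]
    have e1 : -γ / D * β + α / D * δ = 1 := by
      field_simp
      rw [hDdef]; ring
    have e2 : -γ / D * α + α / D * γ = 0 := by ring
    calc p.2 = (-γ / D * α + α / D * γ) • p.1 + (-γ / D * β + α / D * δ) • p.2 := by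
          rw [e1, e2]; simp
      _ = _ := by module

theorem SameOrientedPlane.trans {p p' p'' : H × H} (h : SameOrientedPlane p p')
    (h' : SameOrientedPlane p' p'') : SameOrientedPlane p p'' := by
  obtain ⟨α, β, γ, δ, hD, h1, h2⟩ := h
  obtain ⟨α', β', γ', δ', hD', h1', h2'⟩ := h'
  refine ⟨α' * α + β' * γ, α' * β + β' * δ, γ' * α + δ' * γ, γ' * β + δ' * δ, ?_, ?_, ?_⟩
  · have := mul_pos hD' hD
    nlinarith
  · rw [h1', h1, h2]; module
  · rw [h2', h1, h2]; module

instance posFrameSetoid (q : LinearMap.BilinForm ℝ H) : Setoid (PosFrame q) where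
  r p p' := SameOrientedPlane p.1 p'.1
  iseqv :=
    ⟨fun p => SameOrientedPlane.refl p.1, fun h => SameOrientedPlane.symm h,
      fun h h' => SameOrientedPlane.trans h h'⟩

/-- The period space: the Grassmannian of oriented two-dimensional subspaces of `H` on which `q`
is positive definite. An oriented plane is a class of oriented bases. -/
def Per (q : LinearMap.BilinForm ℝ H) : Type _ :=
  Quotient (posFrameSetoid q)

/-- The usual topology of the Grassmannian: the quotient topology of the space of bases. -/
instance perTopologicalSpace (q : LinearMap.BilinForm ℝ H) : TopologicalSpace (Per q) :=
  inferInstanceAs (TopologicalSpace (Quotient (posFrameSetoid q)))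

theorem SameOrientedPlane.span_le {p p' : H × H} (h : SameOrientedPlane p p') :
    Submodule.span ℝ {p'.1, p'.2} ≤ Submodule.span ℝ {p.1, p.2} := by
  obtain ⟨α, β, γ, δ, -, h1, h2⟩ := h
  rw [Submodule.span_le]
  rintro v (rfl | rfl)
  · exact Submodule.mem_span_pair.2 ⟨α, β, h1.symm⟩
  · exact Submodule.mem_span_pair.2 ⟨γ, δ, h2.symm⟩

/-- The underlying (unoriented) plane of a point of the period space. -/
def Per.plane {q : LinearMap.BilinForm ℝ H} (x : Per q) : Submodule ℝ H :=
  Quotient.lift (fun p : PosFrame q => Submodule.span ℝ {p.1.1, p.1.2})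
    (fun _ _ h => le_antisymm (SameOrientedPlane.span_le (SameOrientedPlane.symm h))
      (SameOrientedPlane.span_le h)) x

/-- The inner product of the bivectors `a ∧ b` and `c ∧ d` in `Λ² H` induced by the Euclidean
metric of `H`. -/
noncomputable def wedgeInner (p p' : H × H) : ℝ :=
  inner ℝ p.1 p'.1 * inner ℝ p.2 p'.2 - inner ℝ p.1 p'.2 * inner ℝ p.2 p'.1

/-- The angle in `[0, π]` between the bivectors `a ∧ b` and `c ∧ d`. -/
noncomputable def wedgeAngle (p p' : H × H) : ℝ :=
  Real.arccos (wedgeInner p p' / (√(wedgeInner p p) * √(wedgeInner p' p')))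

theorem wedgeInner_comm (p p' : H × H) : wedgeInner p p' = wedgeInner p' p := by
  simp only [wedgeInner, real_inner_comm]
  ring

theorem wedgeAngle_comm (p p' : H × H) : wedgeAngle p p' = wedgeAngle p' p := by
  rw [wedgeAngle, wedgeAngle, wedgeInner_comm p p', mul_comm]

theorem wedgeAngle_congr_left {p p' : H × H} (h : SameOrientedPlane p p') (r : H × H) :
    wedgeAngle p r = wedgeAngle p' r := by
  obtain ⟨α, β, γ, δ, hD, h1, h2⟩ := h
  set D := α * δ - β * γ with hDdef
  have key : ∀ s : H × H, wedgeInner p' s = D * wedgeInner p s := by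
    intro s
    simp only [wedgeInner, h1, h2, inner_add_left, real_inner_smul_left]
    rw [hDdef]; ring
  have hself : wedgeInner p' p' = D ^ 2 * wedgeInner p p := by
    rw [key, wedgeInner_comm, key]; ring
  have hsqrt : √(wedgeInner p' p') = D * √(wedgeInner p p) := by
    rw [hself, Real.sqrt_mul (sq_nonneg D), Real.sqrt_sq hD.le]
  rw [wedgeAngle, wedgeAngle, hsqrt, key, mul_assoc, mul_div_mul_left _ _ hD.ne']

theorem wedgeAngle_congr {p p' r r' : H × H} (h : SameOrientedPlane p r)
    (h' : SameOrientedPlane p' r') : wedgeAngle p p' = wedgeAngle r r' := by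
  rw [wedgeAngle_congr_left h p', wedgeAngle_comm, wedgeAngle_congr_left h' r, wedgeAngle_comm]

/-- The distance between two points of a hyperkähler line `S_W` in the metric induced by the
Euclidean metric `g` of `H`. For planes in a common three-dimensional `W`, the Hodge star of
`(W, g)` is an isometry `Λ² W ≅ W` taking an oriented unit bivector to the oriented unit normal of
its plane, so that this is the angle between the oriented normals, that is, the geodesic distance
of the round (Fubini-Study) metric on the sphere `S_W ≅ S² ≅ ℂP¹`. -/
noncomputable def lineDist {q : LinearMap.BilinForm ℝ H} (x y : Per q) : ℝ :=
  Quotient.lift₂ (s₁ := posFrameSetoid q) (s₂ := posFrameSetoid q)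
    (fun p p' : PosFrame q => wedgeAngle p.1 p'.1)
    (fun _ _ _ _ h h' => wedgeAngle_congr h h') x y

/-- The hyperkähler line `S_W`: all oriented planes contained in `W`. -/
def hkLine (q : LinearMap.BilinForm ℝ H) (W : Submodule ℝ H) : Set (Per q) :=
  {x | x.plane ≤ W}

/-- Rational points of `H` with respect to the lattice `L`. -/
def IsRational (L : Submodule ℤ H) (v : H) : Prop :=
  ∃ n : ℤ, n ≠ 0 ∧ n • v ∈ L

/-- Generic hyperkähler lines: the sets `S_W` for positive three-dimensional `W` such that
the `q`-orthogonal complement of `W` has no nonzero rational points. -/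
def IsGHKLine (L : Submodule ℤ H) (q : LinearMap.BilinForm ℝ H) (S : Set (Per q)) : Prop :=
  ∃ W : Submodule ℝ H, Module.finrank ℝ W = 3 ∧ IsPositive q W ∧
    (∀ v, IsRational L v → (∀ w ∈ W, q w v = 0) → v = 0) ∧ S = hkLine q W

/-- A sequence of `n ≥ 1` GHK lines `S₁, …, Sₙ` connecting `x = s₀` to `y = sₙ`, with chosen
points `sᵢ ∈ Sᵢ ∩ Sᵢ₊₁` for `0 < i < n`, and `x ∈ S₁`, `y ∈ Sₙ`. -/
structure GHKChain (L : Submodule ℤ H) (q : LinearMap.BilinForm ℝ H) (x y : Per q) where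
  n : ℕ
  n_pos : 0 < n
  line : Fin n → Set (Per q)
  isGHKLine : ∀ i, IsGHKLine L q (line i)
  pt : Fin (n + 1) → Per q
  pt_zero : pt 0 = x
  pt_last : pt (Fin.last n) = y
  left_mem : ∀ i : Fin n, pt i.castSucc ∈ line i
  right_mem : ∀ i : Fin n, pt i.succ ∈ line i

/-- The total length of the geodesic arcs from `sᵢ` to `sᵢ₊₁` on the line `Sᵢ₊₁`. -/
noncomputable def GHKChain.length {L : Submodule ℤ H} {q : LinearMap.BilinForm ℝ H} {x y : Per q}
    (c : GHKChain L q x y) : ℝ :=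
  ∑ i : Fin c.n, lineDist (c.pt i.castSucc) (c.pt i.succ)

/-- The subtwistor function, with values in `[0, ∞]`; it is `∞` if there is no chain. -/
noncomputable def dtw (L : Submodule ℤ H) (q : LinearMap.BilinForm ℝ H) (x y : Per q) : ENNReal :=
  ⨅ c : GHKChain L q x y, ENNReal.ofReal c.length

end Subtwistor

/-! The angle between the unit bivectors of two oriented planes is defined for every pair of planes,
not only for those in a common `W`, and is the angle between two vectors of a Euclidean space. It
therefore satisfies the triangle inequality, so no chain is shorter than the angle between its ends
(`lineDist_le_dtw`). A plane at small angle to `x` has an oriented basis close to a given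
orthonormal one of `x` (`exists_sameOrientedPlane_dist_le`). Hence `dtw` separates points, and every
open set contains a `dtw`-ball around each of its points.

For upper bounds one needs many GHK lines. A positive `W` is generic as soon as it contains one
vector not orthogonal to any nonzero lattice vector (`isGHKLine_hkLine`). Such vectors are dense by
Baire, while extending a positive pair to a positive triple is an open condition; so every positive
plane lies in generic `W`, and the admissible third vectors span `H`
(`span_generic_posFamily_eq_top`).

Finiteness comes from an explicit chain of four lines (`exists_chain_four`). For the topology, take
a basis of `H` made of admissible third vectors of `x` and reach a nearby frame by changing one
coordinate at a time: each change stays on a GHK line and has small angle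
(`eventually_dtw_partialMove_lt`). So `dtw` from `x` tends to zero at `x`. -/

namespace Subtwistor

open Filter Topology Module

variable {H : Type*} [NormedAddCommGroup H] [InnerProductSpace ℝ H]

/-! ### Positive families and generic vectors -/

/-- The vectors of a finite family are linearly independent and `q` is positive definite on
their span. -/
def PosFamily (q : LinearMap.BilinForm ℝ H) {n : ℕ} (v : Fin n → H) : Prop :=
  ∀ c : Fin n → ℝ, c ≠ 0 → 0 < q (∑ i, c i • v i) (∑ i, c i • v i)

/-- A vector which is not `q`-orthogonal to any nonzero lattice vector. -/
def IsGenericVector (L : Submodule ℤ H) (q : LinearMap.BilinForm ℝ H) (w : H) : Prop :=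
  ∀ v ∈ L, v ≠ 0 → q w v ≠ 0

theorem PosFamily.linearIndependent {q : LinearMap.BilinForm ℝ H} {n : ℕ} {v : Fin n → H}
    (h : PosFamily q v) : LinearIndependent ℝ v := by
  rw [Fintype.linearIndependent_iff]
  intro c hc
  by_contra hne
  have := h c (fun h0 => hne (by simp [h0]))
  simp [hc] at this

theorem PosFamily.isPositive {q : LinearMap.BilinForm ℝ H} {n : ℕ} {v : Fin n → H}
    (h : PosFamily q v) : IsPositive q (Submodule.span ℝ (Set.range v)) := by
  intro w hw hne
  obtain ⟨c, rfl⟩ := (Submodule.mem_span_range_iff_exists_fun ℝ).1 hw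
  exact h c (fun h0 => hne (by simp [h0]))

theorem PosFamily.of_isPositive {q : LinearMap.BilinForm ℝ H} {n : ℕ} {v : Fin n → H}
    {W : Submodule ℝ H} (hW : IsPositive q W) (hv : ∀ i, v i ∈ W)
    (hli : LinearIndependent ℝ v) : PosFamily q v := by
  intro c hc
  refine hW _ (Submodule.sum_mem _ fun i _ => W.smul_mem _ (hv i)) fun h0 => hc ?_
  exact funext (Fintype.linearIndependent_iff.1 hli c h0)

theorem posFamily_pair_iff {q : LinearMap.BilinForm ℝ H} {p : H × H} :
    PosFamily q ![p.1, p.2] ↔ LinearIndependent ℝ ![p.1, p.2] ∧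
      IsPositive q (Submodule.span ℝ {p.1, p.2}) := by
  have e : Set.range ![p.1, p.2] = {p.1, p.2} := by simp [Set.pair_comm]
  constructor
  · intro h
    exact ⟨h.linearIndependent, e ▸ h.isPositive⟩
  · rintro ⟨h, h'⟩
    refine PosFamily.of_isPositive h' (fun i => Submodule.subset_span ?_) h
    rw [← e]
    exact ⟨i, rfl⟩

theorem posFamily_triple_of_orthogonal {q : LinearMap.BilinForm ℝ H} (hsymm : q.IsSymm)
    {a b w : H} (hab : PosFamily q ![a, b]) (hw : 0 < q w w) (ha : q a w = 0) (hb : q b w = 0) :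
    PosFamily q ![a, b, w] := by
  intro c hc
  have ha' : q w a = 0 := (hsymm.eq w a).trans ha
  have hb' : q w b = 0 := (hsymm.eq w b).trans hb
  have key : q (∑ i, c i • ![a, b, w] i) (∑ i, c i • ![a, b, w] i) =
      q (∑ i, ![c 0, c 1] i • ![a, b] i) (∑ i, ![c 0, c 1] i • ![a, b] i) +
        c 2 ^ 2 * q w w := by
    simp [Fin.sum_univ_succ, ha, hb, ha', hb']
    ring
  rw [key]
  by_cases h : ![c 0, c 1] = 0
  · have h2 : c 2 ≠ 0 := by
      intro h2
      apply hc
      have h0 := congrFun h 0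
      have h1 := congrFun h 1
      ext i
      fin_cases i <;> simp_all
    have : 0 < c 2 ^ 2 * q w w := by positivity
    simpa [h] using this
  · have := hab _ h
    positivity

theorem continuous_bilin [FiniteDimensional ℝ H] (q : LinearMap.BilinForm ℝ H) :
    Continuous fun p : H × H => q p.1 p.2 :=
  (LinearMap.toContinuousBilinearMap q).isBoundedBilinearMap.continuous

/-- By homogeneity only coefficients on the unit sphere matter, and compactness of the sphere makes
strict positivity stable under perturbation of the family. -/
theorem isOpen_posFamily [FiniteDimensional ℝ H] (q : LinearMap.BilinForm ℝ H) (n : ℕ) :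
    IsOpen {v : Fin n → H | PosFamily q v} := by
  have e : {v : Fin n → H | PosFamily q v} = {v | ∀ c ∈ Metric.sphere (0 : Fin n → ℝ) 1,
      0 < q (∑ i, c i • v i) (∑ i, c i • v i)} := by
    ext v
    constructor
    · intro h c hc
      exact h c (by rintro rfl; simp at hc)
    · intro h c hc
      have hn : 0 < ‖c‖ := norm_pos_iff.2 hc
      have := h (‖c‖⁻¹ • c) (by simp [norm_smul, hn.ne'])
      have e2 : ∑ i, (‖c‖⁻¹ • c) i • v i = ‖c‖⁻¹ • ∑ i, c i • v i := by
        simp [Finset.smul_sum, mul_smul]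
      rw [e2] at this
      simp only [map_smul, LinearMap.smul_apply, smul_eq_mul] at this
      have hi : 0 < ‖c‖⁻¹ := by positivity
      exact pos_of_mul_pos_right (pos_of_mul_pos_right this hi.le) hi.le
  rw [e, isOpen_iff_mem_nhds]
  intro v hv
  refine (isCompact_sphere (0 : Fin n → ℝ) 1).eventually_forall_of_forall_eventually
    fun c hc => ?_
  have hcont : Continuous fun z : (Fin n → H) × (Fin n → ℝ) =>
      q (∑ i, z.2 i • z.1 i) (∑ i, z.2 i • z.1 i) := by
    have := continuous_bilin q
    have h2 : Continuous fun z : (Fin n → H) × (Fin n → ℝ) => ∑ i, z.2 i • z.1 i := by fun_prop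
    exact this.comp (h2.prodMk h2)
  exact hcont.continuousAt.eventually (lt_mem_nhds (hv c hc))

theorem HasSignatureThree.exists_ne_zero {q : LinearMap.BilinForm ℝ H} (hsymm : q.IsSymm)
    (h : HasSignatureThree q) {v : H} (hv : v ≠ 0) : ∃ u, q u v ≠ 0 := by
  obtain ⟨P, N, hPN, -, hP, hN, hort⟩ := h
  obtain ⟨x, hx, y, hy, rfl⟩ := Submodule.mem_sup.1
    (show v ∈ P ⊔ N by rw [hPN.sup_eq_top]; trivial)
  -- Flipping the sign on the negative part makes both contributions nonnegative: the pairing is `q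
  -- x x - q y y`.
  refine ⟨x - y, ?_⟩
  have h1 := hort x hx y hy
  have h2 : q y x = 0 := (hsymm.eq y x).trans h1
  have e : q (x - y) (x + y) = q x x - q y y := by
    simp [h1, h2]
  rw [e]
  by_cases hx0 : x = 0
  · have hy0 : y ≠ 0 := by rintro rfl; simp [hx0] at hv
    have := hN y hy hy0
    simp [hx0]; exact this.ne
  · have := hP x hx hx0
    by_cases hy0 : y = 0
    · simp [hy0]; exact this.ne'
    · have := hN y hy hy0
      linarith

/-- Two linear conditions on the three-dimensional positive summand leave a nonzero vector
orthogonal to the pair, and it is positive. -/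
theorem HasSignatureThree.exists_posFamily_triple [FiniteDimensional ℝ H]
    {q : LinearMap.BilinForm ℝ H} (hsymm : q.IsSymm) (h : HasSignatureThree q) {a b : H}
    (hab : PosFamily q ![a, b]) : ∃ w, PosFamily q ![a, b, w] := by
  obtain ⟨P, N, -, hrank, hP, -⟩ := h
  let f : P →ₗ[ℝ] ℝ × ℝ := ((q a).prod (q b)).comp P.subtype
  have hker : LinearMap.ker f ≠ ⊥ :=
    LinearMap.ker_ne_bot_of_finrank_lt (by rw [hrank]; simp)
  obtain ⟨w, hw, hw0⟩ := Submodule.exists_mem_ne_zero_of_ne_bot hker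
  have hw' : q a w = 0 ∧ q b w = 0 := by simpa [f] using hw
  exact ⟨w, posFamily_triple_of_orthogonal hsymm hab
    (hP w w.2 (by simpa using hw0)) hw'.1 hw'.2⟩

/-- Baire category: the excluded set is a countable union of the hyperplanes orthogonal to nonzero
lattice vectors, each proper because `q` is nondegenerate. -/
theorem dense_isGenericVector [FiniteDimensional ℝ H] (L : Submodule ℤ H) [DiscreteTopology L] [IsZLattice ℝ L]
    {q : LinearMap.BilinForm ℝ H} (hsymm : q.IsSymm) (hsig : HasSignatureThree q) :
    Dense {w | IsGenericVector L q w} := by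
  have hc : Set.Countable ((L : Set H) \ {0}) := by
    have : Countable L := inferInstance
    exact (Set.to_countable (L : Set H)).mono Set.sdiff_subset
  have e : {w | IsGenericVector L q w} =
      ⋂ v ∈ (L : Set H) \ {0}, ((LinearMap.ker (q.flip v) : Set H))ᶜ := by
    ext w
    simp [IsGenericVector]
  rw [e]
  have : CompleteSpace H := FiniteDimensional.complete ℝ H
  refine dense_biInter_of_isOpen (fun v _ => ?_) hc fun v hv => ?_
  · exact (Submodule.closed_of_finiteDimensional _).isOpen_compl
  · rw [← interior_eq_empty_iff_dense_compl]
    by_contra hne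
    have htop := Submodule.eq_top_of_nonempty_interior' _ (Set.nonempty_iff_ne_empty.2 hne)
    obtain ⟨u, hu⟩ := hsig.exists_ne_zero hsymm (v := v) (by simpa using hv.2)
    apply hu
    have : u ∈ LinearMap.ker (q.flip v) := by rw [htop]; trivial
    simpa using this

/-- Generic vectors extending a positive pair to a positive triple span the space. -/
theorem span_generic_posFamily_eq_top [FiniteDimensional ℝ H] (L : Submodule ℤ H)
    [DiscreteTopology L] [IsZLattice ℝ L] {q : LinearMap.BilinForm ℝ H} (hsymm : q.IsSymm)
    (hsig : HasSignatureThree q) {a b : H} (hab : PosFamily q ![a, b]) :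
    Submodule.span ℝ {w | IsGenericVector L q w ∧ PosFamily q ![a, b, w]} = ⊤ := by
  have hopen : IsOpen {w | PosFamily q ![a, b, w]} := by
    refine (isOpen_posFamily q 3).preimage (f := fun w => ![a, b, w]) ?_
    refine continuous_pi fun i => ?_
    fin_cases i <;> simp <;> fun_prop
  obtain ⟨w, hw⟩ := hsig.exists_posFamily_triple hsymm hab
  refine Submodule.eq_top_of_nonempty_interior' _ ⟨w, ?_⟩
  refine mem_interior.2 ⟨_, ?_, hopen, hw⟩
  have hcl : IsClosed (Submodule.span ℝ {w | IsGenericVector L q w ∧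
      PosFamily q ![a, b, w]} : Set H) := Submodule.closed_of_finiteDimensional _
  -- The open set of admissible vectors lies in the closure of its generic points, hence in their
  -- closed span, which thus has an interior point.
  refine ((dense_isGenericVector L hsymm hsig).open_subset_closure_inter hopen).trans ?_
  refine closure_minimal ?_ hcl
  rintro u ⟨h1, h2⟩
  exact Submodule.subset_span ⟨h2, h1⟩

theorem exists_generic_posFamily [FiniteDimensional ℝ H] (L : Submodule ℤ H)
    [DiscreteTopology L] [IsZLattice ℝ L] {q : LinearMap.BilinForm ℝ H} (hsymm : q.IsSymm)
    (hsig : HasSignatureThree q) {a b : H} (hab : PosFamily q ![a, b]) :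
    ∃ w, IsGenericVector L q w ∧ PosFamily q ![a, b, w] := by
  by_contra! h
  have hs := span_generic_posFamily_eq_top L hsymm hsig hab
  have he : {w | IsGenericVector L q w ∧ PosFamily q ![a, b, w]} = ∅ := by
    ext w
    simpa using h w
  rw [he, Submodule.span_empty] at hs
  have ha : a = 0 := by
    have : a ∈ (⊥ : Submodule ℝ H) := by rw [hs]; trivial
    simpa using this
  exact hab.linearIndependent.ne_zero 0 (by simpa using ha)

/-! ### Generic lines and representatives of period points -/

/-- A rational vector orthogonal to the span has a nonzero integer multiple in `L` orthogonal to the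
generic member, so it vanishes. -/
theorem isGHKLine_hkLine {L : Submodule ℤ H} {q : LinearMap.BilinForm ℝ H} {v : Fin 3 → H}
    (hv : PosFamily q v) {i : Fin 3} (hi : IsGenericVector L q (v i)) :
    IsGHKLine L q (hkLine q (Submodule.span ℝ (Set.range v))) := by
  refine ⟨_, by simpa using finrank_span_eq_card hv.linearIndependent, hv.isPositive, ?_, rfl⟩
  rintro u ⟨n, hn, hnu⟩ hu
  by_contra hne
  refine hi _ hnu ?_ ?_
  · rw [← Int.cast_smul_eq_zsmul ℝ]
    exact smul_ne_zero (by exact_mod_cast hn) hne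
  · rw [← Int.cast_smul_eq_zsmul ℝ, map_smul, hu _ (Submodule.subset_span ⟨i, rfl⟩), smul_zero]

/-- The oriented plane of a positive pair. -/
def Per.mk {q : LinearMap.BilinForm ℝ H} (p : H × H) (hp : PosFamily q ![p.1, p.2]) : Per q :=
  Quotient.mk _ ⟨p, posFamily_pair_iff.1 hp⟩

theorem Per.exists_mk {q : LinearMap.BilinForm ℝ H} (x : Per q) :
    ∃ p hp, x = Per.mk p hp := by
  obtain ⟨⟨p, hp⟩, rfl⟩ := Quotient.exists_rep x
  exact ⟨p, posFamily_pair_iff.2 hp, rfl⟩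

theorem Per.mk_mem_hkLine {q : LinearMap.BilinForm ℝ H} {W : Submodule ℝ H} {p : H × H}
    (hp : PosFamily q ![p.1, p.2]) (h1 : p.1 ∈ W) (h2 : p.2 ∈ W) :
    Per.mk p hp ∈ hkLine q W := by
  change Submodule.span ℝ {p.1, p.2} ≤ W
  rw [Submodule.span_le]
  rintro v (rfl | rfl) <;> assumption

theorem Per.mk_eq_mk {q : LinearMap.BilinForm ℝ H} {p p' : H × H}
    {hp : PosFamily q ![p.1, p.2]} {hp' : PosFamily q ![p'.1, p'.2]} :
    Per.mk p hp = Per.mk p' hp' ↔ SameOrientedPlane p p' :=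
  Quotient.eq (r := posFrameSetoid q)

theorem lineDist_mk {q : LinearMap.BilinForm ℝ H} {p p' : H × H}
    {hp : PosFamily q ![p.1, p.2]} {hp' : PosFamily q ![p'.1, p'.2]} :
    lineDist (Per.mk p hp) (Per.mk p' hp') = wedgeAngle p p' := rfl

/-! ### Angles between bivectors -/

section Angle

/-- The coordinates `aᵢ bⱼ - aⱼ bᵢ` of the bivector `a ∧ b` in an orthonormal basis. -/
noncomputable def bivectorCoord {ι : Type*} [Fintype ι] (e : OrthonormalBasis ι ℝ H)
    (p : H × H) : EuclideanSpace ℝ (ι × ι) :=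
  WithLp.toLp 2 fun k => inner ℝ p.1 (e k.1) * inner ℝ p.2 (e k.2) -
    inner ℝ p.1 (e k.2) * inner ℝ p.2 (e k.1)

/-- The Cauchy–Binet identity; the factor 2 appears because ordered index pairs count each
coordinate of the bivector twice. -/
theorem inner_bivectorCoord {ι : Type*} [Fintype ι] (e : OrthonormalBasis ι ℝ H)
    (p p' : H × H) :
    inner ℝ (bivectorCoord e p) (bivectorCoord e p') = 2 * wedgeInner p p' := by
  have h : ∀ u v : H, inner ℝ u v = ∑ i, inner ℝ u (e i) * inner ℝ v (e i) := by
    intro u v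
    rw [← e.sum_inner_mul_inner u v]
    simp [real_inner_comm]
  have hmul : ∀ u v s t : H, inner ℝ u v * inner ℝ s t =
      ∑ k : ι × ι, inner ℝ u (e k.1) * inner ℝ v (e k.1) *
        (inner ℝ s (e k.2) * inner ℝ t (e k.2)) := by
    intro u v s t
    rw [h u v, h s t, Finset.sum_mul_sum, Fintype.sum_prod_type]
  have hswap : ∀ u v s t : H, inner ℝ u v * inner ℝ s t =
      ∑ k : ι × ι, inner ℝ u (e k.2) * inner ℝ v (e k.2) *
        (inner ℝ s (e k.1) * inner ℝ t (e k.1)) := by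
    intro u v s t
    rw [mul_comm, hmul]
    exact Finset.sum_congr rfl fun k _ => mul_comm _ _
  have e1 : 2 * wedgeInner p p' = (inner ℝ p.1 p'.1 * inner ℝ p.2 p'.2 -
      inner ℝ p.1 p'.2 * inner ℝ p.2 p'.1) + (inner ℝ p.1 p'.1 * inner ℝ p.2 p'.2 -
      inner ℝ p.1 p'.2 * inner ℝ p.2 p'.1) := by rw [wedgeInner]; ring
  rw [e1]
  -- One copy is expanded over `(i, j)` and the other over `(j, i)`, so that the sums agree term by
  -- term.
  nth_rewrite 1 [hmul p.1 p'.1, hmul p.1 p'.2]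
  rw [hswap p.1 p'.1, hswap p.1 p'.2, ← Finset.sum_sub_distrib, ← Finset.sum_sub_distrib,
    ← Finset.sum_add_distrib, PiLp.inner_apply]
  refine Finset.sum_congr rfl fun k _ => ?_
  simp only [bivectorCoord, RCLike.inner_apply, conj_trivial]
  ring

theorem wedgeAngle_eq_angle {ι : Type*} [Fintype ι] (e : OrthonormalBasis ι ℝ H)
    (p p' : H × H) : wedgeAngle p p' =
      InnerProductGeometry.angle (bivectorCoord e p) (bivectorCoord e p') := by
  rw [wedgeAngle, InnerProductGeometry.angle, inner_bivectorCoord]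
  have hn : ∀ r : H × H, ‖bivectorCoord e r‖ = √2 * √(wedgeInner r r) := by
    intro r
    rw [norm_eq_sqrt_real_inner, inner_bivectorCoord, Real.sqrt_mul (by norm_num)]
  have h2 : √2 * √2 = (2 : ℝ) := Real.mul_self_sqrt (by norm_num)
  rw [hn, hn, show √2 * √(wedgeInner p p) * (√2 * √(wedgeInner p' p')) =
    2 * (√(wedgeInner p p) * √(wedgeInner p' p')) by rw [mul_mul_mul_comm, h2],
    mul_div_mul_left _ _ two_ne_zero]

theorem wedgeAngle_triangle [FiniteDimensional ℝ H] (p p' p'' : H × H) :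
    wedgeAngle p p'' ≤ wedgeAngle p p' + wedgeAngle p' p'' := by
  simp only [wedgeAngle_eq_angle (stdOrthonormalBasis ℝ H)]
  exact InnerProductGeometry.angle_le_angle_add_angle _ _ _

/-- Gram-Schmidt for oriented pairs. -/
theorem exists_orthonormal_sameOrientedPlane {p : H × H} (hp : LinearIndependent ℝ ![p.1, p.2]) :
    ∃ r : H × H, SameOrientedPlane p r ∧ ‖r.1‖ = 1 ∧ ‖r.2‖ = 1 ∧ inner ℝ r.1 r.2 = 0 := by
  obtain ⟨a, b⟩ := p
  have ha : a ≠ 0 := hp.ne_zero 0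
  have hna : ‖a‖ ≠ 0 := norm_ne_zero_iff.2 ha
  set s : ℝ := inner ℝ a b / ‖a‖ ^ 2 with hs
  have hd : b - s • a ≠ 0 := by
    intro h
    have := LinearIndependent.pair_iff.1 hp (-s) 1 (by rw [← h]; module)
    exact one_ne_zero this.2
  have hnd : ‖b - s • a‖ ≠ 0 := norm_ne_zero_iff.2 hd
  refine ⟨(‖a‖⁻¹ • a, ‖b - s • a‖⁻¹ • (b - s • a)),
    ⟨‖a‖⁻¹, 0, -(‖b - s • a‖⁻¹ * s), ‖b - s • a‖⁻¹, ?_, ?_, ?_⟩, ?_, ?_, ?_⟩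
  · have h1 : 0 < ‖a‖ := norm_pos_iff.2 ha
    have h2 : 0 < ‖b - s • a‖ := norm_pos_iff.2 hd
    rw [zero_mul, sub_zero]
    positivity
  · simp
  · simp only
    module
  · simp [norm_smul, hna]
  · simp [norm_smul, hnd]
  · simp only [real_inner_smul_left, real_inner_smul_right, inner_sub_right,
      real_inner_self_eq_norm_sq]
    rw [hs]
    field_simp
    ring

theorem wedgeInner_self_of_orthonormal {r : H × H} (h1 : ‖r.1‖ = 1) (h2 : ‖r.2‖ = 1)
    (h : inner ℝ r.1 r.2 = 0) : wedgeInner r r = 1 := by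
  simp [wedgeInner, h, h1, h2]

theorem wedgeInner_self_pos {p : H × H} (hp : LinearIndependent ℝ ![p.1, p.2]) :
    0 < wedgeInner p p := by
  obtain ⟨r, hr, h1, h2, h⟩ := exists_orthonormal_sameOrientedPlane hp
  obtain ⟨α, β, γ, δ, hD, e1, e2⟩ := hr.symm
  have : wedgeInner p p = (α * δ - β * γ) ^ 2 * wedgeInner r r := by
    simp only [wedgeInner, e1, e2, inner_add_left, inner_add_right, real_inner_smul_left,
      real_inner_smul_right]
    rw [real_inner_comm r.1 r.2]
    ring
  rw [this, wedgeInner_self_of_orthonormal h1 h2 h]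
  positivity

theorem wedgeAngle_self {p : H × H} (hp : LinearIndependent ℝ ![p.1, p.2]) :
    wedgeAngle p p = 0 := by
  have := wedgeInner_self_pos hp
  rw [wedgeAngle, Real.mul_self_sqrt this.le, div_self this.ne', Real.arccos_one]

theorem wedgeAngle_nonneg (p p' : H × H) : 0 ≤ wedgeAngle p p' := Real.arccos_nonneg _

theorem continuousAt_wedgeAngle {p p' : H × H} (hp : LinearIndependent ℝ ![p.1, p.2])
    (hp' : LinearIndependent ℝ ![p'.1, p'.2]) :
    ContinuousAt (fun z : (H × H) × (H × H) => wedgeAngle z.1 z.2) (p, p') := by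
  have h1 := wedgeInner_self_pos hp
  have h2 := wedgeInner_self_pos hp'
  unfold wedgeAngle
  refine Real.continuous_arccos.continuousAt.comp (ContinuousAt.div ?_ ?_ ?_)
  · unfold wedgeInner; fun_prop
  · unfold wedgeInner; fun_prop
  · have := Real.sqrt_pos.2 h1
    have := Real.sqrt_pos.2 h2
    positivity

/-- If an orthonormal pair `p` makes a small angle with the oriented plane of an orthonormal
pair `r`, then the orthogonal projection of `p` to that plane is an oriented basis close to `p`. -/
theorem exists_sameOrientedPlane_dist_le {p r : H × H} (hp1 : ‖p.1‖ = 1) (hp2 : ‖p.2‖ = 1)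
    (hp : inner ℝ p.1 p.2 = 0) (hr1 : ‖r.1‖ = 1) (hr2 : ‖r.2‖ = 1) (hr : inner ℝ r.1 r.2 = 0)
    (hone : wedgeAngle p r < 1) :
    ∃ s, SameOrientedPlane r s ∧ dist s p ≤ wedgeAngle p r := by
  obtain ⟨a, b⟩ := p
  obtain ⟨c, d⟩ := r
  simp only at hp1 hp2 hp hr1 hr2 hr
  set M := wedgeInner (a, b) (c, d) with hM
  have hang : wedgeAngle (a, b) (c, d) = Real.arccos M := by
    rw [wedgeAngle, wedgeInner_self_of_orthonormal hp1 hp2 hp,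
      wedgeInner_self_of_orthonormal hr1 hr2 hr]
    simp [hM]
  -- The bound 1 on the angle serves only to place it below `π / 2`.
  have hMpos : 0 < M := by
    rw [← Real.arccos_lt_pi_div_two, ← hang]
    linarith [Real.pi_gt_three]
  -- With `M` the cosine of the angle, this is `sin θ ≤ θ`.
  have hMδ : 1 - M ^ 2 ≤ wedgeAngle (a, b) (c, d) ^ 2 := by
    have hs : √(1 - M ^ 2) ≤ wedgeAngle (a, b) (c, d) := by
      rw [← Real.sin_arccos, hang]
      exact Real.sin_le (Real.arccos_nonneg _)
    exact (Real.sqrt_le_iff.1 hs).2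
  have hproj : ∀ u : H, ‖u‖ = 1 → ‖(inner ℝ u c • c + inner ℝ u d • d) - u‖ ^ 2 =
      1 - inner ℝ u c ^ 2 - inner ℝ u d ^ 2 := by
    intro u hu
    have hr' : inner ℝ d c = 0 := by rw [real_inner_comm]; exact hr
    have hc : inner ℝ c c = (1 : ℝ) := by rw [real_inner_self_eq_norm_sq, hr1, one_pow]
    have hd : inner ℝ d d = (1 : ℝ) := by rw [real_inner_self_eq_norm_sq, hr2, one_pow]
    have hu' : inner ℝ u u = (1 : ℝ) := by rw [real_inner_self_eq_norm_sq, hu, one_pow]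
    rw [← real_inner_self_eq_norm_sq]
    simp only [inner_sub_left, inner_sub_right, inner_add_left, inner_add_right,
      real_inner_smul_left, real_inner_smul_right, hr, hr',
      hc, hd, hu', real_inner_comm u c, real_inner_comm u d]
    ring
  have hbessel : ∀ u : H, ‖u‖ = 1 → inner ℝ u c ^ 2 + inner ℝ u d ^ 2 ≤ 1 := by
    intro u hu
    have := hproj u hu
    nlinarith [sq_nonneg ‖(inner ℝ u c • c + inner ℝ u d • d) - u‖]
  have hMdef : M = inner ℝ a c * inner ℝ b d - inner ℝ a d * inner ℝ b c := rfl
  -- Hadamard's inequality for the 2 × 2 matrix of inner products. As both rows have norm at most 1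
  -- by Bessel, each row has squared norm at least `M ^ 2`.
  have hcs : M ^ 2 ≤ (inner ℝ a c ^ 2 + inner ℝ a d ^ 2) * (inner ℝ b c ^ 2 + inner ℝ b d ^ 2) := by
    rw [hMdef]
    nlinarith [sq_nonneg ((inner ℝ a c : ℝ) * inner ℝ b c + inner ℝ a d * inner ℝ b d)]
  have hA := hbessel a hp1
  have hB := hbessel b hp2
  have hMa : M ^ 2 ≤ inner ℝ a c ^ 2 + inner ℝ a d ^ 2 :=
    hcs.trans (mul_le_of_le_one_right (by positivity) hB)
  have hMb : M ^ 2 ≤ inner ℝ b c ^ 2 + inner ℝ b d ^ 2 :=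
    hcs.trans (mul_le_of_le_one_left (by positivity) hA)
  -- The projections of `a` and `b`; their change-of-basis determinant is `M`, so `0 < M` gives the
  -- orientation.
  refine ⟨(inner ℝ a c • c + inner ℝ a d • d, inner ℝ b c • c + inner ℝ b d • d),
    ⟨_, _, _, _, hMdef ▸ hMpos, rfl, rfl⟩, ?_⟩
  rw [Prod.dist_eq, max_le_iff, dist_eq_norm, dist_eq_norm]
  constructor
  · refine (sq_le_sq₀ (norm_nonneg _) (wedgeAngle_nonneg _ _)).1 ?_
    rw [hproj a hp1]; linarith
  · refine (sq_le_sq₀ (norm_nonneg _) (wedgeAngle_nonneg _ _)).1 ?_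
    rw [hproj b hp2]; linarith

theorem PosFamily.of_sameOrientedPlane {q : LinearMap.BilinForm ℝ H} {p p' : H × H}
    (hp : PosFamily q ![p.1, p.2]) (h : SameOrientedPlane p p') : PosFamily q ![p'.1, p'.2] := by
  obtain ⟨α, β, γ, δ, hD, h1, h2⟩ := h
  intro c hc
  have key : ∑ i, c i • ![p'.1, p'.2] i =
      ∑ i, ![c 0 * α + c 1 * γ, c 0 * β + c 1 * δ] i • ![p.1, p.2] i := by
    simp only [Fin.sum_univ_two, h1, h2, Matrix.cons_val_zero, Matrix.cons_val_one]
    module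
  rw [key]
  refine hp _ fun h0 => hc ?_
  have e0 : c 0 * α + c 1 * γ = 0 := congrFun h0 0
  have e1 : c 0 * β + c 1 * δ = 0 := congrFun h0 1
  have f0 : c 0 * (α * δ - β * γ) = 0 := by linear_combination δ * e0 - γ * e1
  have f1 : c 1 * (α * δ - β * γ) = 0 := by linear_combination α * e1 - β * e0
  ext i
  fin_cases i
  · exact (mul_eq_zero.1 f0).resolve_right hD.ne'
  · exact (mul_eq_zero.1 f1).resolve_right hD.ne'

theorem Per.exists_mk_orthonormal {q : LinearMap.BilinForm ℝ H} (x : Per q) :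
    ∃ p hp, x = Per.mk p hp ∧ ‖p.1‖ = 1 ∧ ‖p.2‖ = 1 ∧ inner ℝ p.1 p.2 = 0 := by
  obtain ⟨p, hp, rfl⟩ := x.exists_mk
  obtain ⟨r, hr, h⟩ := exists_orthonormal_sameOrientedPlane hp.linearIndependent
  exact ⟨r, hp.of_sameOrientedPlane hr, Per.mk_eq_mk.2 hr, h⟩

end Angle

/-! ### The angle as a distance on the period space -/

section LineDist

variable {q : LinearMap.BilinForm ℝ H}

theorem lineDist_nonneg (x y : Per q) : 0 ≤ lineDist x y := by
  obtain ⟨p, hp, rfl⟩ := x.exists_mk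
  obtain ⟨p', hp', rfl⟩ := y.exists_mk
  exact wedgeAngle_nonneg _ _

theorem lineDist_comm (x y : Per q) : lineDist x y = lineDist y x := by
  obtain ⟨p, hp, rfl⟩ := x.exists_mk
  obtain ⟨p', hp', rfl⟩ := y.exists_mk
  exact wedgeAngle_comm _ _

theorem lineDist_self (x : Per q) : lineDist x x = 0 := by
  obtain ⟨p, hp, rfl⟩ := x.exists_mk
  exact wedgeAngle_self hp.linearIndependent

theorem lineDist_triangle [FiniteDimensional ℝ H] (x y z : Per q) :
    lineDist x z ≤ lineDist x y + lineDist y z := by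
  obtain ⟨p, hp, rfl⟩ := x.exists_mk
  obtain ⟨p', hp', rfl⟩ := y.exists_mk
  obtain ⟨p'', hp'', rfl⟩ := z.exists_mk
  exact wedgeAngle_triangle _ _ _

theorem lineDist_le_sum [FiniteDimensional ℝ H] {n : ℕ} (s : Fin (n + 1) → Per q) :
    lineDist (s 0) (s (Fin.last n)) ≤ ∑ i : Fin n, lineDist (s i.castSucc) (s i.succ) := by
  induction n with
  | zero => simp [lineDist_self]
  | succ n ih =>
    rw [Fin.sum_univ_castSucc]
    refine (lineDist_triangle _ (s (Fin.last n).castSucc) _).trans ?_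
    exact add_le_add (ih fun i => s i.castSucc) le_rfl

/-- Planes at a small angle from `x` lie in any given neighbourhood of `x`. -/
theorem exists_lineDist_lt_mem {U : Set (Per q)} (hU : IsOpen U) {x : Per q} (hx : x ∈ U) :
    ∃ ε : ℝ, 0 < ε ∧ ∀ y, lineDist x y < ε → y ∈ U := by
  obtain ⟨p, hp, rfl, hp1, hp2, hp12⟩ := x.exists_mk_orthonormal
  have hU' : IsOpen (Quotient.mk (posFrameSetoid q) ⁻¹' U) := hU.preimage continuous_quotient_mk'
  obtain ⟨δ, hδ, hball⟩ := Metric.isOpen_iff.1 hU' ⟨p, posFamily_pair_iff.1 hp⟩ hx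
  refine ⟨min δ 1, by positivity, fun y hy => ?_⟩
  obtain ⟨r, hr, rfl, hr1, hr2, hr12⟩ := y.exists_mk_orthonormal
  rw [lineDist_mk, lt_min_iff] at hy
  obtain ⟨s, hs, hsd⟩ := exists_sameOrientedPlane_dist_le hp1 hp2 hp12 hr1 hr2 hr12 hy.2
  rw [Per.mk_eq_mk (hp' := hr.of_sameOrientedPlane hs) |>.2 hs]
  exact hball (show _ ∈ Metric.ball _ _ from hsd.trans_lt hy.1)

end LineDist

/-! ### Operations on chains and bounds for the subtwistor function -/

section Chains

variable {L : Submodule ℤ H} {q : LinearMap.BilinForm ℝ H} {x y z : Per q}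

/-- The chain of one GHK line. -/
def GHKChain.single {S : Set (Per q)} (hS : IsGHKLine L q S) (hx : x ∈ S) (hy : y ∈ S) :
    GHKChain L q x y where
  n := 1
  n_pos := one_pos
  line _ := S
  isGHKLine _ := hS
  pt := ![x, y]
  pt_zero := rfl
  pt_last := rfl
  left_mem i := by fin_cases i; exact hx
  right_mem i := by fin_cases i; exact hy

theorem GHKChain.length_single {S : Set (Per q)} (hS : IsGHKLine L q S) (hx : x ∈ S)
    (hy : y ∈ S) : (GHKChain.single hS hx hy).length = lineDist x y :=
  Fin.sum_univ_one _

/-- The chain traversed backwards. -/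
def GHKChain.reverse (c : GHKChain L q x y) : GHKChain L q y x where
  n := c.n
  n_pos := c.n_pos
  line i := c.line i.rev
  isGHKLine i := c.isGHKLine i.rev
  pt i := c.pt i.rev
  pt_zero := by rw [Fin.rev_zero, c.pt_last]
  pt_last := by rw [Fin.rev_last, c.pt_zero]
  left_mem i := by rw [Fin.rev_castSucc]; exact c.right_mem i.rev
  right_mem i := by rw [Fin.rev_succ]; exact c.left_mem i.rev

theorem GHKChain.length_reverse (c : GHKChain L q x y) : c.reverse.length = c.length := by
  refine (Equiv.sum_comp Fin.revPerm fun i : Fin c.n =>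
    lineDist (c.pt i.castSucc) (c.pt i.succ)).symm.trans ?_ |>.symm
  refine Finset.sum_congr rfl fun i _ => ?_
  rw [lineDist_comm]
  simp [GHKChain.reverse, Fin.rev_castSucc, Fin.rev_succ]

/-- The points of a concatenation of chains. -/
def GHKChain.transPt (c : GHKChain L q x y) (c' : GHKChain L q y z)
    (i : Fin (c.n + c'.n + 1)) : Per q :=
  if h : (i : ℕ) ≤ c.n then c.pt ⟨i, by omega⟩ else c'.pt ⟨i - c.n, by omega⟩

theorem GHKChain.transPt_of_le (c : GHKChain L q x y) (c' : GHKChain L q y z)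
    {i : Fin (c.n + c'.n + 1)} {j : Fin (c.n + 1)} (h : (i : ℕ) = j) :
    c.transPt c' i = c.pt j := by
  rw [transPt, dif_pos (by omega)]
  congr 1
  exact Fin.ext h

theorem GHKChain.transPt_of_ge (c : GHKChain L q x y) (c' : GHKChain L q y z)
    {i : Fin (c.n + c'.n + 1)} {j : Fin (c'.n + 1)} (h : (i : ℕ) = c.n + j) :
    c.transPt c' i = c'.pt j := by
  by_cases hj : (j : ℕ) = 0
  · rw [c.transPt_of_le c' (j := Fin.last c.n) (by simp [h, hj])]
    exact (c.pt_last.trans c'.pt_zero.symm).trans (congrArg c'.pt (Fin.ext hj.symm))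
  · rw [transPt, dif_neg (by omega)]
    congr 1
    ext
    simp [h]

/-- The concatenation of two chains. -/
def GHKChain.trans (c : GHKChain L q x y) (c' : GHKChain L q y z) : GHKChain L q x z where
  n := c.n + c'.n
  n_pos := Nat.add_pos_left c.n_pos _
  line := Fin.addCases c.line c'.line
  isGHKLine i := by
    refine Fin.addCases (fun j => ?_) (fun j => ?_) i
    · rw [Fin.addCases_left]; exact c.isGHKLine j
    · rw [Fin.addCases_right]; exact c'.isGHKLine j
  pt := c.transPt c'
  pt_zero := by rw [c.transPt_of_le c' (j := 0) rfl, c.pt_zero]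
  pt_last := by rw [c.transPt_of_ge c' (j := Fin.last c'.n) rfl, c'.pt_last]
  left_mem i := by
    refine Fin.addCases (fun j => ?_) (fun j => ?_) i
    · rw [Fin.addCases_left, c.transPt_of_le c' (j := j.castSucc) rfl]; exact c.left_mem j
    · rw [Fin.addCases_right, c.transPt_of_ge c' (j := j.castSucc) rfl]; exact c'.left_mem j
  right_mem i := by
    refine Fin.addCases (fun j => ?_) (fun j => ?_) i
    · rw [Fin.addCases_left, c.transPt_of_le c' (j := j.succ) rfl]; exact c.right_mem j
    · rw [Fin.addCases_right, c.transPt_of_ge c' (j := j.succ) rfl]; exact c'.right_mem j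

theorem GHKChain.length_trans (c : GHKChain L q x y) (c' : GHKChain L q y z) :
    (c.trans c').length = c.length + c'.length := by
  refine (Fin.sum_univ_add (a := c.n) (b := c'.n) fun i =>
    lineDist (c.transPt c' i.castSucc) (c.transPt c' i.succ)).trans ?_
  congr 1
  · refine Finset.sum_congr rfl fun j _ => ?_
    rw [c.transPt_of_le c' (j := j.castSucc) rfl, c.transPt_of_le c' (j := j.succ) rfl]
  · refine Finset.sum_congr rfl fun j _ => ?_
    rw [c.transPt_of_ge c' (j := j.castSucc) rfl, c.transPt_of_ge c' (j := j.succ) rfl]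

theorem GHKChain.length_nonneg (c : GHKChain L q x y) : 0 ≤ c.length :=
  Finset.sum_nonneg fun _ _ => lineDist_nonneg _ _

theorem GHKChain.lineDist_le_length [FiniteDimensional ℝ H] (c : GHKChain L q x y) :
    lineDist x y ≤ c.length := by
  have := lineDist_le_sum c.pt
  rwa [c.pt_zero, c.pt_last] at this

theorem dtw_le_lineDist {S : Set (Per q)} (hS : IsGHKLine L q S) (hx : x ∈ S) (hy : y ∈ S) :
    dtw L q x y ≤ ENNReal.ofReal (lineDist x y) := by
  rw [← GHKChain.length_single hS hx hy]
  exact iInf_le _ _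

theorem lineDist_le_dtw [FiniteDimensional ℝ H] (x y : Per q) :
    ENNReal.ofReal (lineDist x y) ≤ dtw L q x y :=
  le_iInf fun c => ENNReal.ofReal_le_ofReal c.lineDist_le_length

theorem dtw_comm (x y : Per q) : dtw L q x y = dtw L q y x := by
  have h : ∀ x y : Per q, dtw L q x y ≤ dtw L q y x := fun x y =>
    le_iInf fun c => by
      rw [← c.length_reverse]
      exact iInf_le _ _
  exact le_antisymm (h x y) (h y x)

theorem dtw_triangle (x y z : Per q) : dtw L q x z ≤ dtw L q x y + dtw L q y z := by
  refine ENNReal.le_iInf_add_iInf fun c c' => ?_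
  rw [← ENNReal.ofReal_add c.length_nonneg c'.length_nonneg, ← c.length_trans c']
  exact iInf_le _ _

end Chains

/-! ### Four connecting lines and separation of points -/

theorem PosFamily.comp {q : LinearMap.BilinForm ℝ H} {n m : ℕ} {v : Fin n → H}
    (hv : PosFamily q v) {f : Fin m → Fin n} (hf : Function.Injective f) :
    PosFamily q (v ∘ f) :=
  PosFamily.of_isPositive hv.isPositive (fun i => Submodule.subset_span ⟨f i, rfl⟩)
    (hv.linearIndependent.comp f hf)

theorem exists_ne_zero_orthogonal (q : LinearMap.BilinForm ℝ H) {W : Submodule ℝ H}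
    (hW : finrank ℝ W = 3) (u v : H) : ∃ c ∈ W, c ≠ 0 ∧ q u c = 0 ∧ q v c = 0 := by
  let f : W →ₗ[ℝ] ℝ × ℝ := ((q u).prod (q v)).comp W.subtype
  have : FiniteDimensional ℝ W := .of_finrank_pos (by omega)
  have hker : LinearMap.ker f ≠ ⊥ :=
    LinearMap.ker_ne_bot_of_finrank_lt (by rw [hW]; simp)
  obtain ⟨c, hc, hc0⟩ := Submodule.exists_mem_ne_zero_of_ne_bot hker
  have hc' : q u c = 0 ∧ q v c = 0 := by simpa [f] using hc
  exact ⟨c, c.2, by simpa using hc0, hc'.1, hc'.2⟩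

/-- With generic `w`, `d` completing the two planes, choose `c` in the span of `a, b, w` orthogonal
to `d, a'`, and `f` there orthogonal to `d, c`. The planes `(a, b)`, `(c, f)`, `(c, d)`, `(d, a')`,
`(a', b')` are consecutively joined by the spans of `a, b, w`; `c, f, d`; `d, a', c`; `a', b', d`,
each containing `w` or `d`. -/
theorem exists_chain_four [FiniteDimensional ℝ H] {L : Submodule ℤ H} [DiscreteTopology L]
    [IsZLattice ℝ L] {q : LinearMap.BilinForm ℝ H} (hsymm : q.IsSymm)
    (hsig : HasSignatureThree q) (x y : Per q) : ∃ c : GHKChain L q x y, c.n = 4 := by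
  obtain ⟨⟨a, b⟩, hab, rfl⟩ := x.exists_mk
  obtain ⟨⟨a', b'⟩, hab', rfl⟩ := y.exists_mk
  obtain ⟨w, hw, habw⟩ := exists_generic_posFamily L hsymm hsig hab
  obtain ⟨d, hd, habd⟩ := exists_generic_posFamily L hsymm hsig hab'
  simp only at habw habd
  have hdd : 0 < q d d :=
    habd.isPositive d (Submodule.subset_span ⟨2, rfl⟩) (habd.linearIndependent.ne_zero 2)
  have hda : PosFamily q ![d, a'] := by
    convert habd.comp (f := ![2, 0]) (by decide) using 1
    ext i; fin_cases i <;> rfl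
  have hW : finrank ℝ (Submodule.span ℝ (Set.range ![a, b, w])) = 3 := by
    simpa using finrank_span_eq_card habw.linearIndependent
  obtain ⟨c, hcW, hc0, hdc, hac⟩ := exists_ne_zero_orthogonal q hW d a'
  obtain ⟨f, hfW, hf0, hdf, hcf⟩ := exists_ne_zero_orthogonal q hW d c
  have hcc := habw.isPositive c hcW hc0
  have hff := habw.isPositive f hfW hf0
  have hfc : q f c = 0 := (hsymm.eq f c).trans hcf
  have hcf_pos : PosFamily q ![c, f] := by
    refine PosFamily.of_isPositive habw.isPositive (fun i => by fin_cases i <;> assumption) ?_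
    rw [LinearIndependent.pair_iff]
    intro s t hst
    have h1 := congrArg (q c) hst
    have h2 := congrArg (q f) hst
    simp only [map_add, map_smul, smul_eq_mul, hcf, hfc, map_zero] at h1 h2
    constructor
    · exact (mul_eq_zero.1 (by simpa using h1)).resolve_right hcc.ne'
    · exact (mul_eq_zero.1 (by simpa using h2)).resolve_right hff.ne'
  have hcfd : PosFamily q ![c, f, d] := posFamily_triple_of_orthogonal hsymm hcf_pos hdd
    ((hsymm.eq c d).trans hdc) ((hsymm.eq f d).trans hdf)
  have hdac : PosFamily q ![d, a', c] := posFamily_triple_of_orthogonal hsymm hda hcc hdc hac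
  have hcd : PosFamily q ![c, d] := by
    convert hcfd.comp (f := ![0, 2]) (by decide) using 1
    ext i; fin_cases i <;> rfl
  have mem : ∀ (v : Fin 3 → H) (i : Fin 3), v i ∈ Submodule.span ℝ (Set.range v) :=
    fun v i => Submodule.subset_span ⟨i, rfl⟩
  let c₁ : GHKChain L q (Per.mk (a, b) hab) (Per.mk (c, f) hcf_pos) :=
    .single (isGHKLine_hkLine habw (i := 2) hw)
      (Per.mk_mem_hkLine _ (mem ![a, b, w] 0) (mem ![a, b, w] 1)) (Per.mk_mem_hkLine _ hcW hfW)
  let c₂ : GHKChain L q (Per.mk (c, f) hcf_pos) (Per.mk (c, d) hcd) :=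
    .single (isGHKLine_hkLine hcfd (i := 2) hd)
      (Per.mk_mem_hkLine _ (mem ![c, f, d] 0) (mem ![c, f, d] 1))
      (Per.mk_mem_hkLine _ (mem ![c, f, d] 0) (mem ![c, f, d] 2))
  let c₃ : GHKChain L q (Per.mk (c, d) hcd) (Per.mk (d, a') hda) :=
    .single (isGHKLine_hkLine hdac (i := 0) hd)
      (Per.mk_mem_hkLine _ (mem ![d, a', c] 2) (mem ![d, a', c] 0))
      (Per.mk_mem_hkLine _ (mem ![d, a', c] 0) (mem ![d, a', c] 1))
  let c₄ : GHKChain L q (Per.mk (d, a') hda) (Per.mk (a', b') hab') :=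
    .single (isGHKLine_hkLine habd (i := 2) hd)
      (Per.mk_mem_hkLine _ (mem ![a', b', d] 2) (mem ![a', b', d] 0))
      (Per.mk_mem_hkLine _ (mem ![a', b', d] 0) (mem ![a', b', d] 1))
  exact ⟨((c₁.trans c₂).trans c₃).trans c₄, rfl⟩

/-- Chains have at least one line, so a GHK line through `x` is needed even here. -/
theorem dtw_self [FiniteDimensional ℝ H] (L : Submodule ℤ H) [DiscreteTopology L]
    [IsZLattice ℝ L] {q : LinearMap.BilinForm ℝ H} (hsymm : q.IsSymm)
    (hsig : HasSignatureThree q) (x : Per q) : dtw L q x x = 0 := by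
  obtain ⟨⟨a, b⟩, hab, rfl⟩ := x.exists_mk
  obtain ⟨w, hw, habw⟩ := exists_generic_posFamily L hsymm hsig hab
  have hx : Per.mk (a, b) hab ∈ hkLine q (Submodule.span ℝ (Set.range ![a, b, w])) :=
    Per.mk_mem_hkLine _ (Submodule.subset_span ⟨0, rfl⟩) (Submodule.subset_span ⟨1, rfl⟩)
  have := dtw_le_lineDist (isGHKLine_hkLine habw (i := 2) hw) hx hx
  simpa [lineDist_self] using this

theorem eq_of_lineDist_eq_zero {q : LinearMap.BilinForm ℝ H} {x y : Per q}
    (h : lineDist x y = 0) : x = y := by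
  obtain ⟨p, hp, rfl, hp1, hp2, hp12⟩ := x.exists_mk_orthonormal
  obtain ⟨r, hr, rfl, hr1, hr2, hr12⟩ := y.exists_mk_orthonormal
  rw [lineDist_mk] at h
  obtain ⟨s, hs, hsd⟩ :=
    exists_sameOrientedPlane_dist_le hp1 hp2 hp12 hr1 hr2 hr12 (by rw [h]; exact one_pos)
  rw [h, dist_le_zero] at hsd
  exact Per.mk_eq_mk.2 (hsd ▸ hs).symm

/-! ### Small moves along generic directions -/

theorem PosFamily.add_smul {q : LinearMap.BilinForm ℝ H} {p : H × H} {w : H}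
    (h : PosFamily q ![p.1, p.2, w]) (s t : ℝ) :
    PosFamily q ![(p + (s • w, t • w)).1, (p + (s • w, t • w)).2] := by
  intro c hc
  have key : ∑ i, c i • ![(p + (s • w, t • w)).1, (p + (s • w, t • w)).2] i =
      ∑ i, ![c 0, c 1, c 0 * s + c 1 * t] i • ![p.1, p.2, w] i := by
    simp [Fin.sum_univ_succ]
    module
  rw [key]
  refine h _ fun h0 => hc ?_
  ext i
  fin_cases i
  · exact congrFun h0 0
  · exact congrFun h0 1

/-- Shifting both frame vectors along `w` keeps the plane inside the span of the triple, a single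
GHK line. -/
theorem dtw_add_smul_le {L : Submodule ℤ H} {q : LinearMap.BilinForm ℝ H} {p : H × H} {w : H}
    (hp : PosFamily q ![p.1, p.2]) (h : PosFamily q ![p.1, p.2, w])
    (hw : IsGenericVector L q w) (s t : ℝ) :
    dtw L q (Per.mk p hp) (Per.mk (p + (s • w, t • w)) (h.add_smul s t)) ≤
      ENNReal.ofReal (wedgeAngle p (p + (s • w, t • w))) := by
  have mem : ∀ i, ![p.1, p.2, w] i ∈ Submodule.span ℝ (Set.range ![p.1, p.2, w]) :=
    fun i => Submodule.subset_span ⟨i, rfl⟩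
  exact dtw_le_lineDist (isGHKLine_hkLine h (i := 2) hw)
    (Per.mk_mem_hkLine _ (mem 0) (mem 1))
    (Per.mk_mem_hkLine _ (Submodule.add_mem _ (mem 0) (Submodule.smul_mem _ _ (mem 2)))
      (Submodule.add_mem _ (mem 1) (Submodule.smul_mem _ _ (mem 2))))

/-- The pair obtained from `p₀` by moving the coordinates in `S` to those of `p`. -/
noncomputable def partialMove {ι : Type*} (B : Basis ι ℝ H) (p₀ : H × H) (S : Finset ι)
    (p : H × H) : H × H :=
  p₀ + ∑ i ∈ S, (B.repr (p.1 - p₀.1) i • B i, B.repr (p.2 - p₀.2) i • B i)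

theorem partialMove_insert {ι : Type*} [DecidableEq ι] (B : Basis ι ℝ H) (p₀ : H × H)
    {S : Finset ι} {i : ι} (hi : i ∉ S) (p : H × H) :
    partialMove B p₀ (insert i S) p = partialMove B p₀ S p +
      (B.repr (p.1 - p₀.1) i • B i, B.repr (p.2 - p₀.2) i • B i) := by
  rw [partialMove, partialMove, Finset.sum_insert hi]
  abel

theorem partialMove_univ {ι : Type*} [Fintype ι] (B : Basis ι ℝ H) (p₀ p : H × H) :
    partialMove B p₀ Finset.univ p = p := by
  rw [partialMove]
  ext <;> simp [Prod.fst_sum, Prod.snd_sum, -map_sub, B.sum_repr]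

theorem tendsto_partialMove [FiniteDimensional ℝ H] {ι : Type*} (B : Basis ι ℝ H) (p₀ : H × H)
    (S : Finset ι) : Tendsto (partialMove B p₀ S) (𝓝 p₀) (𝓝 p₀) := by
  have hc : ∀ i, Continuous fun v : H => B.repr v i := fun i =>
    (B.coord i).continuous_of_finiteDimensional
  have hcont : Continuous (partialMove B p₀ S) := by
    refine continuous_const.add (continuous_finsetSum _ fun i _ => ?_)
    exact (((hc i).comp (by fun_prop : Continuous fun p : H × H => p.1 - p₀.1)).smul
      continuous_const).prodMk (((hc i).comp
        (by fun_prop : Continuous fun p : H × H => p.2 - p₀.2)).smul continuous_const)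
  have h0 : partialMove B p₀ S p₀ = p₀ := by simp [partialMove]
  simpa [h0] using hcont.tendsto p₀

theorem eventually_dtw_partialMove_lt [FiniteDimensional ℝ H] {L : Submodule ℤ H}
    {q : LinearMap.BilinForm ℝ H} {p₀ : H × H} (hp₀ : PosFamily q ![p₀.1, p₀.2])
    (hself : dtw L q (Per.mk p₀ hp₀) (Per.mk p₀ hp₀) = 0) {ι : Type*} (B : Basis ι ℝ H)
    (hB : ∀ i, IsGenericVector L q (B i)) (hpos : ∀ i, PosFamily q ![p₀.1, p₀.2, B i])
    (S : Finset ι) : ∀ ε : ENNReal, 0 < ε → ∀ᶠ p in 𝓝 p₀,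
      ∃ h, dtw L q (Per.mk p₀ hp₀) (Per.mk (partialMove B p₀ S p) h) < ε := by
  classical
  induction S using Finset.induction_on with
  | empty =>
    intro ε hε
    refine Eventually.of_forall fun p => ?_
    have : partialMove B p₀ ∅ p = p₀ := by simp [partialMove]
    rw [this]
    exact ⟨hp₀, hself ▸ hε⟩
  | insert i S hi ih =>
    intro ε hε
    have h2 : 0 < ε / 2 := ENNReal.half_pos hε.ne'
    -- The next direction was chosen for `p₀`; openness keeps it admissible at the partially moved
    -- frame.
    have htriple : ∀ᶠ p in 𝓝 p₀,
        PosFamily q ![(partialMove B p₀ S p).1, (partialMove B p₀ S p).2, B i] := by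
      have ho : IsOpen {r : H × H | PosFamily q ![r.1, r.2, B i]} := by
        refine (isOpen_posFamily q 3).preimage (f := fun r : H × H => ![r.1, r.2, B i]) ?_
        refine continuous_pi fun j => ?_
        fin_cases j <;> simp <;> fun_prop
      exact (tendsto_partialMove B p₀ S).eventually (ho.mem_nhds (hpos i))
    have hangle : ∀ᶠ p in 𝓝 p₀, ENNReal.ofReal
        (wedgeAngle (partialMove B p₀ S p) (partialMove B p₀ (insert i S) p)) < ε / 2 := by
      -- Both partially moved frames tend to `p₀`, so their angle tends to that of `p₀` with itself,
      -- which is zero.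
      have ht := (continuousAt_wedgeAngle hp₀.linearIndependent hp₀.linearIndependent).tendsto.comp
        ((tendsto_partialMove B p₀ S).prodMk_nhds (tendsto_partialMove B p₀ (insert i S)))
      have ht' := (ENNReal.continuous_ofReal.tendsto _).comp ht
      simp only [wedgeAngle_self hp₀.linearIndependent, ENNReal.ofReal_zero] at ht'
      exact ht'.eventually (gt_mem_nhds h2)
    filter_upwards [ih (ε / 2) h2, htriple, hangle] with p ⟨h, hlt⟩ h3 ha
    rw [partialMove_insert B p₀ hi] at ha ⊢
    refine ⟨h3.add_smul _ _, ?_⟩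
    calc _ ≤ _ := dtw_triangle _ (Per.mk (partialMove B p₀ S p) h) _
      _ < ε / 2 + ε / 2 :=
        ENNReal.add_lt_add hlt ((dtw_add_smul_le h h3 (hB i) _ _).trans_lt ha)
      _ = ε := ENNReal.add_halves ε

theorem eventually_dtw_lt [FiniteDimensional ℝ H] (L : Submodule ℤ H) [DiscreteTopology L]
    [IsZLattice ℝ L] {q : LinearMap.BilinForm ℝ H} (hsymm : q.IsSymm)
    (hsig : HasSignatureThree q) {p₀ : H × H} (hp₀ : PosFamily q ![p₀.1, p₀.2]) {ε : ENNReal}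
    (hε : 0 < ε) : ∀ᶠ p in 𝓝 p₀, ∃ h, dtw L q (Per.mk p₀ hp₀) (Per.mk p h) < ε := by
  have hspan := span_generic_posFamily_eq_top L hsymm hsig hp₀
  let B := Basis.ofSpan hspan.ge
  have hB : ∀ i, B i ∈ {w | IsGenericVector L q w ∧ PosFamily q ![p₀.1, p₀.2, w]} := fun i =>
    Basis.ofSpan_subset hspan.ge ⟨i, rfl⟩
  have : Fintype _ := FiniteDimensional.fintypeBasisIndex B
  have := eventually_dtw_partialMove_lt hp₀ (dtw_self L hsymm hsig _) B (fun i => (hB i).1)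
    (fun i => (hB i).2) Finset.univ ε hε
  simpa only [partialMove_univ] using this

/-- In the quotient topology openness is tested on frames, where `eventually_dtw_lt` puts a
neighbourhood of each frame inside the ball. -/
theorem isOpen_of_forall_dtw_ball [FiniteDimensional ℝ H] {L : Submodule ℤ H}
    [DiscreteTopology L] [IsZLattice ℝ L] {q : LinearMap.BilinForm ℝ H} (hsymm : q.IsSymm)
    (hsig : HasSignatureThree q) {U : Set (Per q)}
    (hU : ∀ x ∈ U, ∃ ε : ENNReal, 0 < ε ∧ ∀ y, dtw L q x y < ε → y ∈ U) : IsOpen U := by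
  refine (isQuotientMap_quotient_mk' (s := posFrameSetoid q)).isOpen_preimage.1 ?_
  rw [isOpen_iff_mem_nhds]
  rintro ⟨p₀, hp₀⟩ hmem
  obtain ⟨ε, hε, hball⟩ := hU _ hmem
  have := (continuous_subtype_val.tendsto (⟨p₀, hp₀⟩ : PosFrame q)).eventually
    (eventually_dtw_lt L hsymm hsig (posFamily_pair_iff.2 hp₀) hε)
  filter_upwards [this] with p ⟨h, hp⟩
  exact hball _ hp

end Subtwistor

theorem mainTheorem10 {H : Type*} [NormedAddCommGroup H] [InnerProductSpace ℝ H]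
    [FiniteDimensional ℝ H]
    (L : Submodule ℤ H) [DiscreteTopology L] [IsZLattice ℝ L]
    (q : LinearMap.BilinForm ℝ H) (hsymm : q.IsSymm)
    (hint : ∀ u ∈ L, ∀ v ∈ L, ∃ n : ℤ, q u v = n)
    (hsig : Subtwistor.HasSignatureThree q) :
    -- any two points are joined by four sequentially intersecting GHK lines
    (∀ x y : Subtwistor.Per q, ∃ c : Subtwistor.GHKChain L q x y, c.n = 4) ∧
    -- the subtwistor function is a (finite) metric
    ((∀ x y : Subtwistor.Per q, Subtwistor.dtw L q x y < ⊤) ∧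
      (∀ x y : Subtwistor.Per q, Subtwistor.dtw L q x y = 0 ↔ x = y) ∧
      (∀ x y : Subtwistor.Per q, Subtwistor.dtw L q x y = Subtwistor.dtw L q y x) ∧
      (∀ x y z : Subtwistor.Per q,
        Subtwistor.dtw L q x z ≤ Subtwistor.dtw L q x y + Subtwistor.dtw L q y z)) ∧
    -- its metric topology is the usual topology of the period space
    (∀ U : Set (Subtwistor.Per q), IsOpen U ↔
      ∀ x ∈ U, ∃ ε : ENNReal, 0 < ε ∧ ∀ y, Subtwistor.dtw L q x y < ε → y ∈ U) := by
  refine ⟨Subtwistor.exists_chain_four hsymm hsig, ⟨fun x y => ?_, fun x y => ⟨fun h => ?_, ?_⟩,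
    Subtwistor.dtw_comm, Subtwistor.dtw_triangle⟩, fun U => ⟨fun hU x hx => ?_,
    Subtwistor.isOpen_of_forall_dtw_ball hsymm hsig⟩⟩
  · obtain ⟨c, -⟩ := Subtwistor.exists_chain_four (L := L) hsymm hsig x y
    exact (iInf_le _ c).trans_lt ENNReal.ofReal_lt_top
  · have h0 := Subtwistor.lineDist_le_dtw (L := L) x y
    rw [h, nonpos_iff_eq_zero, ENNReal.ofReal_eq_zero] at h0
    exact Subtwistor.eq_of_lineDist_eq_zero (h0.antisymm (Subtwistor.lineDist_nonneg x y))
  · rintro rfl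
    exact Subtwistor.dtw_self L hsymm hsig x
  · obtain ⟨ε, hε, hball⟩ := Subtwistor.exists_lineDist_lt_mem hU hx
    refine ⟨ENNReal.ofReal ε, ENNReal.ofReal_pos.2 hε, fun y hy => hball y ?_⟩
    exact (ENNReal.ofReal_lt_ofReal_iff hε).1 ((Subtwistor.lineDist_le_dtw x y).trans_lt hy)
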